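/- Let $K$ be a field of prime characteristic $p$, let $n\geq 2$ be an integer, and let $\mathfrak{S}_n$ be the symmetric group on $n$ letters. The representation ring (Green ring) of $K\mathfrak{S}_n$ is the commutative ring generated by the isomorphism classes $[V]$ of finite-dimensional $K\mathfrak{S}_n$-modules, with $[V\oplus W]=[V]+[W]$ and $[V\otimes W]=[V][W]$. Let $M=M^{(n-1,1)}$ be the natural $n$-dimensional permutation module with permutation basis $x_1,\dots,x_n$, let $S^{(n-1,1)}$ be the kernel of the surjection $M\to K$, $x_i\mapsto 1$ (the Specht module labelled by $(n-1,1)$), and let $D^{(n-1,1)}$ be the head of $S^{(n-1,1)}$, i.e. its quotient by the intersection of its maximal submodules. Write $\operatorname{Sym}^r V$ for the $r$-th symmetric power of $V$, i.e. the degree $r$ part of the symmetric algebra of $V$. Then in the representation ring of $K\mathfrak{S}_n$ we have \[ [\operatorname{Sym}^r S^{(n-1,1)}] = [\operatorname{Sym}^r M^{(n-1,1)}] - [\operatorname{Sym}^{r-1} M^{(n-1,1)}] \] for all $2\leq r\leq p-1$. If moreover $p\mid n$, then \[ [\operatorname{Sym}^r D^{(n-1,1)}] = [\operatorname{Sym}^r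 M^{(n-1,1)}] + [\operatorname{Sym}^{r-2} M^{(n-1,1)}] - 2[\operatorname{Sym}^{r-1} M^{(n-1,1)}] \] for all $3\leq r\leq p-1$. -/

import Mathlib

open CategoryTheory
open scoped MonoidAlgebra

universe u

noncomputable section

/-! ### Symmetric powers of a representation -/

/-- The `r`-th symmetric power of a `K`-module `V`: the degree `r` part of the symmetric algebra
of `V`, i.e. the span of all products of `r` elements of `V`. -/
abbrev SymPower (K : Type u) [Field K] (V : Type u) [AddCommGroup V] [Module K V] (r : ℕ) :
    Submodule K (SymmetricAlgebra K V) :=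
  LinearMap.range (SymmetricAlgebra.ι K V) ^ r

instance SymPower.finite (K : Type u) [Field K] (V : Type u) [AddCommGroup V] [Module K V]
    [Module.Finite K V] (r : ℕ) : Module.Finite K (SymPower K V r) :=
  Module.Finite.iff_fg.mpr
    (Submodule.FG.pow (Module.Finite.iff_fg.mp (Module.Finite.range (SymmetricAlgebra.ι K V))) r)

/-- The action of `G` on the symmetric algebra of a representation `ρ` by algebra
endomorphisms, extending the action on `V`. -/
def symAlgRep {K : Type u} [Field K] {G : Type*} [Group G] {V : Type u} [AddCommGroup V]
    [Module K V] (ρ : Representation K G V) : Representation K G (SymmetricAlgebra K V) where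
  toFun g := (SymmetricAlgebra.lift (SymmetricAlgebra.ι K V ∘ₗ ρ g)).toLinearMap
  map_one' := by
    have h : SymmetricAlgebra.lift (SymmetricAlgebra.ι K V ∘ₗ ρ 1)
        = AlgHom.id K (SymmetricAlgebra K V) :=
      SymmetricAlgebra.algHom_ext (LinearMap.ext fun v => by simp)
    rw [h]
    rfl
  map_mul' g h := by
    have e : SymmetricAlgebra.lift (SymmetricAlgebra.ι K V ∘ₗ ρ (g * h))
        = (SymmetricAlgebra.lift (SymmetricAlgebra.ι K V ∘ₗ ρ g)).comp
          (SymmetricAlgebra.lift (SymmetricAlgebra.ι K V ∘ₗ ρ h)) :=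
      SymmetricAlgebra.algHom_ext (LinearMap.ext fun v => by simp)
    rw [e]
    rfl

theorem symAlgRep_mem_symPower {K : Type u} [Field K] {G : Type*} [Group G] {V : Type u}
    [AddCommGroup V] [Module K V] (ρ : Representation K G V) (r : ℕ) (g : G) :
    SymPower K V r ≤ (SymPower K V r).comap (symAlgRep ρ g) := by
  rw [← Submodule.map_le_iff_le_comap]
  change Submodule.map (SymmetricAlgebra.lift (SymmetricAlgebra.ι K V ∘ₗ ρ g)).toLinearMap
    (LinearMap.range (SymmetricAlgebra.ι K V) ^ r) ≤ _
  rw [Submodule.map_pow]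
  refine pow_le_pow_left' ?_ r
  rintro _ ⟨_, ⟨v, rfl⟩, rfl⟩
  exact ⟨ρ g v, by simp⟩

/-- The representation `Sym^r V` of `G`. -/
def symPowerRep {K : Type u} [Field K] {G : Type*} [Group G] {V : Type u} [AddCommGroup V]
    [Module K V] (ρ : Representation K G V) (r : ℕ) : Representation K G (SymPower K V r) :=
  (symAlgRep ρ).subrepresentation (SymPower K V r) (symAlgRep_mem_symPower ρ r)

/-! ### The head of a representation -/

/-- The radical of a representation: the intersection of its maximal subrepresentations
(maximal `K[G]`-submodules), as a subrepresentation. -/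
def radRep {K : Type u} [Field K] {G : Type*} [Group G] {V : Type u} [AddCommGroup V]
    [Module K V] (ρ : Representation K G V) : Subrepresentation ρ :=
  Subrepresentation.ofSubmodule' (Module.jacobson K[G] ρ.asModule)

/-- The head of a representation: its quotient by its radical. -/
def headRep {K : Type u} [Field K] {G : Type*} [Group G] {V : Type u} [AddCommGroup V]
    [Module K V] (ρ : Representation K G V) :
    Representation K G (V ⧸ (radRep ρ).toSubmodule) :=
  ρ.quotient (radRep ρ).toSubmodule fun g _ hv => (radRep ρ).apply_mem_toSubmodule g hv

/-! ### The modules `M^{(n-1,1)}`, `S^{(n-1,1)}` and `D^{(n-1,1)}` of the symmetric group -/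

/-- `M^{(n-1,1)}`: the natural permutation module, with basis `x_i = single i 1`, `i : Fin n`. -/
abbrev natPermRep (K : Type u) [Field K] (n : ℕ) :
    Representation K (Equiv.Perm (Fin n)) K[Fin n] :=
  Representation.ofMulAction K (Equiv.Perm (Fin n)) (Fin n)

/-- The surjection `M^{(n-1,1)} → K` sending each basis element `x_i` to `1`. -/
def natPermAug (K : Type u) [Field K] (n : ℕ) :
    (natPermRep K n).IntertwiningMap (Representation.trivial K (Equiv.Perm (Fin n)) K) where
  toLinearMap :=
    (Finsupp.linearCombination K fun _ : Fin n => (1 : K)) ∘ₗ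
      (MonoidAlgebra.coeffLinearEquiv K).toLinearMap
  isIntertwining' g := by
    ext i
    simp [MonoidAlgebra.coeffLinearEquiv]

/-- `S^{(n-1,1)}`: the kernel of `M^{(n-1,1)} → K`. -/
def spechtRep (K : Type u) [Field K] (n : ℕ) :
    Representation K (Equiv.Perm (Fin n)) (natPermAug K n).ker.toSubmodule :=
  (natPermAug K n).ker.toRepresentation

/-- `D^{(n-1,1)}`: the head of `S^{(n-1,1)}`. -/
abbrev simpleHeadRep (K : Type u) [Field K] (n : ℕ) :
    Representation K (Equiv.Perm (Fin n))
      ((natPermAug K n).ker.toSubmodule ⧸ (radRep (spechtRep K n)).toSubmodule) :=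
  headRep (spechtRep K n)

/-! ### The representation ring -/

/-- The ideal of relations `[V ⊕ W] = [V] + [W]` in the monoid ring `ℤ[Iso]`, where `Iso` is the
commutative monoid of isomorphism classes of finite-dimensional representations under `⊗`. -/
def repRingRelations (K : Type u) [Field K] (G : Type*) [Group G] :
    Ideal ℤ[Skeleton (FDRep K G)] :=
  Ideal.span {x | ∃ V W : FDRep K G,
    x = MonoidAlgebra.of ℤ _ (toSkeleton (FDRep.of (Representation.prod V.ρ W.ρ)))
      - (MonoidAlgebra.of ℤ _ (toSkeleton V) + MonoidAlgebra.of ℤ _ (toSkeleton W))}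

/-- The representation ring (Green ring) of `KG`: generated by the isomorphism classes of
finite-dimensional `KG`-modules, with sum given by direct sum and product by tensor product. -/
abbrev RepRing (K : Type u) [Field K] (G : Type*) [Group G] :=
  ℤ[Skeleton (FDRep K G)] ⧸ repRingRelations K G

/-- The class `[V]` of a finite-dimensional representation in the representation ring. -/
def repClass {K : Type u} [Field K] {G : Type*} [Group G] {V : Type u} [AddCommGroup V]
    [Module K V] [Module.Finite K V] (ρ : Representation K G V) : RepRing K G :=
  Ideal.Quotient.mk (repRingRelations K G) (MonoidAlgebra.of ℤ _ (toSkeleton (FDRep.of ρ)))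

end

/-! Identify `Sym M` with `K[x_1, …, x_n]` and let `∂ = ∑ ∂/∂x_i`, the derivation extending the
augmentation. The first formula comes from the equivariant sequence `0 → Sym^r S → Sym^r M →
Sym^{r-1} M → 0` with second map `∂`. In degrees below `p` its kernel is exactly `Sym^r S`
(`symMap_symMap_of_derivation_eq_zero`), so the point is to split it equivariantly.

If `∂ y = 1` for a linear form `y`, then `∑ (-1)^k / (k+1)! • y^{k+1} ∂^k` is a right inverse of `∂`
in small degrees (`mul_weylRight`). An invariant `y` would be the average of all variables, which
does not exist when `p ∣ n`. Instead the polynomials of degree `m = r - 1` are split by the supports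
`I` of their monomials. Since `1 ≤ |I| ≤ m < p`, the average `y_I` of the variables in `I` exists
and can be used on that piece. Permutations carry `y_I` to `y_{gI}`, so the sum over all `I` is
equivariant (`derivSection`).

For the second formula, `e = ∑ x_i` lies in `S` when `p ∣ n`, and for `n ≥ 3` it spans the radical
(`mem_radRep_spechtRep`). Hence `Sym D` is `Sym S` modulo `e`, giving `0 → Sym^{r-1} S → Sym^r S →
Sym^r D → 0` with first map multiplication by `e`. The dual integration operator, with the
derivatives averaged over `I`, gives an equivariant retraction of multiplication by `e` on `Sym M`
(`mulRetraction`). Following it by `1 - s ∂`, with `s` the section above, forces its values into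
`ker ∂ = Sym S`, and the sequence splits. Combining the two splittings gives the formula for `D`. -/

noncomputable section

/-! ### Split exact sequences in the representation ring -/

section RepRing

variable {K : Type u} [Field K] {G : Type*} [Group G]
  {A B C : Type u} [AddCommGroup A] [Module K A] [Module.Finite K A]
  [AddCommGroup B] [Module K B] [Module.Finite K B]
  [AddCommGroup C] [Module K C] [Module.Finite K C]

/-- Equivariantly isomorphic representations have the same class. -/
theorem repClass_congr {α : Representation K G A} {β : Representation K G B} (e : A ≃ₗ[K] B)
    (he : ∀ g a, e (α g a) = β g (e a)) : repClass α = repClass β := by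
  have i : FDRep.of α ≅ FDRep.of β := by
    refine Action.mkIso (LinearEquiv.toFGModuleCatIso e) fun g => ?_
    ext a
    exact he g a
  unfold repClass
  rw [toSkeleton_eq_toSkeleton_iff.mpr ⟨i⟩]

theorem repClass_prod (α : Representation K G A) (γ : Representation K G C) :
    repClass (α.prod γ) = repClass α + repClass γ := by
  unfold repClass
  rw [← map_add, Ideal.Quotient.mk_eq_mk_iff_sub_mem]
  exact Ideal.subset_span ⟨FDRep.of α, FDRep.of γ, rfl⟩

/-- The class of a representation is additive on exact sequences with an equivariant section. -/
theorem repClass_eq_add_of_section {α : Representation K G A} {β : Representation K G B}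
    {γ : Representation K G C} (i : A →ₗ[K] B) (q : B →ₗ[K] C) (s : C →ₗ[K] B)
    (hi : ∀ g a, i (α g a) = β g (i a)) (hs : ∀ g c, s (γ g c) = β g (s c))
    (inj : Function.Injective i) (hqi : ∀ a, q (i a) = 0) (hker : ∀ b, q b = 0 → ∃ a, i a = b)
    (hqs : ∀ c, q (s c) = c) : repClass β = repClass α + repClass γ := by
  rw [← repClass_prod]
  refine (repClass_congr (LinearEquiv.ofBijective (i.coprod s) ⟨?_, fun b => ?_⟩) ?_).symm
  · rw [injective_iff_map_eq_zero]
    rintro ⟨a, c⟩ h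
    simp only [LinearMap.coprod_apply] at h
    have hc : c = 0 := by simpa [hqi, hqs] using congr(q $h)
    subst hc
    have ha : a = 0 := inj (by simpa using h)
    simp [ha]
  · obtain ⟨a, ha⟩ := hker (b - s (q b)) (by simp [hqs])
    exact ⟨(a, q b), by simp [ha]⟩
  · rintro g ⟨a, c⟩
    change i (α g a) + s (γ g c) = β g (i a + s c)
    rw [map_add, hi, hs]

/-- The class of a representation is additive on exact sequences with an equivariant
retraction. -/
theorem repClass_eq_add_of_retraction {α : Representation K G A} {β : Representation K G B}
    {γ : Representation K G C} (i : A →ₗ[K] B) (q : B →ₗ[K] C) (t : B →ₗ[K] A)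
    (hq : ∀ g b, q (β g b) = γ g (q b)) (ht : ∀ g b, t (β g b) = α g (t b))
    (surj : Function.Surjective q) (hqi : ∀ a, q (i a) = 0) (hker : ∀ b, q b = 0 → ∃ a, i a = b)
    (hti : ∀ a, t (i a) = a) : repClass β = repClass α + repClass γ := by
  rw [← repClass_prod]
  refine repClass_congr (LinearEquiv.ofBijective (t.prod q) ⟨?_, ?_⟩) ?_
  · rw [injective_iff_map_eq_zero]
    intro b h
    have h1 : t b = 0 := congr(Prod.fst $h)
    obtain ⟨a, rfl⟩ := hker b congr(Prod.snd $h)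
    rw [hti] at h1
    simp [h1]
  · rintro ⟨a, c⟩
    obtain ⟨b, rfl⟩ := surj c
    exact ⟨b - i (t b) + i a, by simp [hti, hqi]⟩
  · intro g b
    change (t (β g b), q (β g b)) = (α g (t b), γ g (q b))
    rw [hq, ht]

end RepRing

/-! ### Integration operators attached to a Weyl pair -/

section Weyl

variable {K : Type*} [Field K] {E : Type*} [Ring E] [Algebra K E] {D X : E}

/-- `D` acts like the derivative with respect to `X`: this is the commutator `[D, X^{k+1}] = (k+1)
X^k`. The next lemma is its mirror image. -/
theorem mul_pow_succ_of_weyl (h : D * X = X * D + 1) (k : ℕ) :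
    D * X ^ (k + 1) = X ^ (k + 1) * D + (k + 1 : K) • X ^ k := by
  induction k with
  | zero => simpa using h
  | succ k ih =>
    rw [pow_succ X (k + 1), ← mul_assoc, ih, add_mul, mul_assoc, h, smul_mul_assoc, ← pow_succ,
      mul_add, mul_one, ← mul_assoc, Nat.cast_succ, add_smul (_ + _), one_smul]
    abel

theorem pow_succ_mul_of_weyl (h : D * X = X * D + 1) (k : ℕ) :
    D ^ (k + 1) * X = X * D ^ (k + 1) + (k + 1 : K) • D ^ k := by
  induction k with
  | zero => simpa using h
  | succ k ih =>
    rw [pow_succ' D (k + 1), mul_assoc, ih, mul_add, ← mul_assoc, h, mul_smul_comm, ← pow_succ',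
      add_mul, one_mul, mul_assoc, Nat.cast_succ, add_smul (_ + _), one_smul]
    abel

variable (K) in
/-- The coefficient `(-1)^k / (k + 1)!` of the integration operators. -/
def weylCoeff (k : ℕ) : K := (-1) ^ k / ((k + 1).factorial : K)

variable (K D X) in
/-- The truncated right integration operator of a Weyl pair. -/
def weylRight (N : ℕ) : E := ∑ k ∈ Finset.range N, weylCoeff K k • (X ^ (k + 1) * D ^ k)

variable (K D X) in
/-- The truncated left integration operator of a Weyl pair. -/
def weylLeft (N : ℕ) : E := ∑ k ∈ Finset.range N, weylCoeff K k • (X ^ k * D ^ (k + 1))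

theorem weylCoeff_mul {k : ℕ} (hk : ((k + 1).factorial : K) ≠ 0) :
    weylCoeff K k * (k + 1) = (-1) ^ k / (k.factorial : K) := by
  rw [Nat.factorial_succ, Nat.cast_mul, mul_ne_zero_iff] at hk
  have h1 := hk.1
  have h2 := hk.2
  rw [weylCoeff, Nat.factorial_succ]
  push_cast at *
  field_simp

theorem factorial_ne_zero_of_succ {N : ℕ} (hN : ((N + 1).factorial : K) ≠ 0) :
    (N.factorial : K) ≠ 0 := by
  rw [Nat.factorial_succ, Nat.cast_mul, mul_ne_zero_iff] at hN
  exact hN.2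

/-- The condition `m! ≠ 0` in `K` is the working form of "`m` is below the characteristic". It
inverts both the coefficients of the integration operators and the sizes of supports. -/
theorem natCast_ne_zero_of_factorial {k m : ℕ} (hm : (m.factorial : K) ≠ 0) (h1 : 1 ≤ k)
    (h2 : k ≤ m) : (k : K) ≠ 0 := by
  intro h0
  obtain ⟨c, hc⟩ := Nat.dvd_factorial h1 h2
  rw [hc, Nat.cast_mul, h0, zero_mul] at hm
  exact hm rfl

/-- The sum telescopes: `D` times the `k`-th term is a combination of `X^{k+1} D^{k+1}` and `X^k
D^k`, and the coefficients are chosen so that neighbouring terms cancel. What remains contains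
`D^N`, which vanishes in degrees below `N`. -/
theorem mul_weylRight (h : D * X = X * D + 1) {N : ℕ} (hN : (N.factorial : K) ≠ 0) :
    D * weylRight K D X N = 1 - ((-1) ^ N / (N.factorial : K)) • (X ^ N * D ^ N) := by
  induction N with
  | zero => simp [weylRight]
  | succ N ih =>
    have e : D * (X ^ (N + 1) * D ^ N)
        = X ^ (N + 1) * D ^ (N + 1) + (N + 1 : K) • (X ^ N * D ^ N) := by
      rw [← mul_assoc, mul_pow_succ_of_weyl (K := K) h, add_mul, mul_assoc, ← pow_succ',
        smul_mul_assoc]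
    rw [weylRight, Finset.sum_range_succ, mul_add, ← weylRight,
      ih (factorial_ne_zero_of_succ hN), mul_smul_comm, e, smul_add, smul_smul,
      weylCoeff_mul hN, weylCoeff, pow_succ (-1 : K) N, mul_neg_one, neg_div, neg_smul]
    abel

theorem weylLeft_mul (h : D * X = X * D + 1) {N : ℕ} (hN : (N.factorial : K) ≠ 0) :
    weylLeft K D X N * X = 1 - ((-1) ^ N / (N.factorial : K)) • (X ^ N * D ^ N) := by
  induction N with
  | zero => simp [weylLeft]
  | succ N ih =>
    have e : X ^ N * D ^ (N + 1) * X
        = X ^ (N + 1) * D ^ (N + 1) + (N + 1 : K) • (X ^ N * D ^ N) := by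
      rw [mul_assoc, pow_succ_mul_of_weyl (K := K) h, mul_add, ← mul_assoc, ← pow_succ,
        mul_smul_comm]
    rw [weylLeft, Finset.sum_range_succ, add_mul, ← weylLeft,
      ih (factorial_ne_zero_of_succ hN), smul_mul_assoc, e, smul_add, smul_smul,
      weylCoeff_mul hN, weylCoeff, pow_succ (-1 : K) N, mul_neg_one, neg_div, neg_smul]
    abel

theorem SemiconjBy.sum_right {ι : Type*} {R : E} {x y : ι → E} (s : Finset ι)
    (h : ∀ i ∈ s, SemiconjBy R (x i) (y i)) : SemiconjBy R (∑ i ∈ s, x i) (∑ i ∈ s, y i) := by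
  rw [SemiconjBy, Finset.mul_sum, Finset.sum_mul]
  exact Finset.sum_congr rfl fun i hi => h i hi

theorem SemiconjBy.smul_right_of_algebra {R x y : E} (h : SemiconjBy R x y) (c : K) :
    SemiconjBy R (c • x) (c • y) := by
  rw [SemiconjBy, mul_smul_comm, smul_mul_assoc, h.eq]

/-- Semiconjugation rather than commutation, because a permutation `g` turns the operators attached
to a support `I` into those attached to `gI`. -/
theorem SemiconjBy.weylRight {R D' X' : E} (hD : SemiconjBy R D D') (hX : SemiconjBy R X X')
    (N : ℕ) : SemiconjBy R (weylRight K D X N) (weylRight K D' X' N) :=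
  .sum_right _ fun k _ => ((hX.pow_right (k + 1)).mul_right (hD.pow_right k)).smul_right_of_algebra _

theorem SemiconjBy.weylLeft {R D' X' : E} (hD : SemiconjBy R D D') (hX : SemiconjBy R X X')
    (N : ℕ) : SemiconjBy R (weylLeft K D X N) (weylLeft K D' X' N) :=
  .sum_right _ fun k _ => ((hX.pow_right k).mul_right (hD.pow_right (k + 1))).smul_right_of_algebra _

end Weyl

/-! ### Equivariant operators on polynomial rings -/

namespace MvPolynomial

variable {σ : Type*} {K : Type*} [Field K]

/-- A permutation of the variables as an endomorphism. -/
def renameEnd (g : Equiv.Perm σ) : Module.End K (MvPolynomial σ K) := (rename g).toLinearMap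

theorem renameEnd_apply (g : Equiv.Perm σ) (f : MvPolynomial σ K) :
    renameEnd g f = rename g f := rfl

/-- Projection to the span of the monomials with support `I`. -/
def suppProj [DecidableEq σ] (I : Finset σ) : Module.End K (MvPolynomial σ K) :=
  (basisMonomials σ K).constr K fun a => if a.support = I then monomial a 1 else 0

theorem suppProj_monomial [DecidableEq σ] (I : Finset σ) (a : σ →₀ ℕ) (c : K) :
    suppProj I (monomial a c) = if a.support = I then monomial a c else 0 := by
  have : monomial a c = c • basisMonomials σ K a := by simp [smul_monomial]
  rw [this, map_smul, suppProj, Module.Basis.constr_basis]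
  split_ifs <;> simp

theorem suppProj_eq_sum [DecidableEq σ] (I : Finset σ) (f : MvPolynomial σ K) :
    suppProj I f = ∑ a ∈ f.support, if a.support = I then monomial a (f.coeff a) else 0 := by
  conv_lhs => rw [f.as_sum, map_sum]
  exact Finset.sum_congr rfl fun a _ => suppProj_monomial I a _

theorem semiconjBy_suppProj [DecidableEq σ] (g : Equiv.Perm σ) (I : Finset σ) :
    SemiconjBy (renameEnd g) (suppProj I : Module.End K (MvPolynomial σ K))
      (suppProj (I.map g.toEmbedding)) := by
  refine (basisMonomials σ K).ext fun a => ?_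
  have h : (a.mapDomain g).support = a.support.map g.toEmbedding := by
    rw [Finsupp.mapDomain_support_of_injective g.injective, Finset.map_eq_image]
    rfl
  simp only [Module.End.mul_apply, coe_basisMonomials, renameEnd_apply, suppProj_monomial,
    rename_monomial, h, Finset.map_inj]
  split_ifs <;> simp [rename_monomial]

variable (K) in
/-- The weights of the average of the variables in `I`. -/
def avgWeight [DecidableEq σ] (I : Finset σ) : σ → K := fun i => if i ∈ I then (I.card : K)⁻¹ else 0

theorem avgWeight_comp_symm [DecidableEq σ] (g : Equiv.Perm σ) (I : Finset σ) :
    avgWeight K I ∘ g.symm = avgWeight K (I.map g.toEmbedding) := by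
  ext i
  simp [avgWeight, Finset.mem_map_equiv]

theorem IsHomogeneous.degree_eq_of_mem_support {f : MvPolynomial σ K} {m : ℕ}
    (hf : f.IsHomogeneous m) {a : σ →₀ ℕ} (ha : a ∈ f.support) : a.degree = m := by
  have h := hf (mem_support_iff.mp ha)
  rwa [show (1 : σ → ℕ) = fun _ => 1 from rfl, ← Finsupp.degree_eq_weight_one] at h

theorem IsHomogeneous.suppProj {f : MvPolynomial σ K} {m : ℕ} (hf : f.IsHomogeneous m)
    [DecidableEq σ] (I : Finset σ) : (suppProj I f).IsHomogeneous m := by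
  rw [suppProj_eq_sum]
  refine IsHomogeneous.sum _ _ _ fun a ha => ?_
  split_ifs
  · exact isHomogeneous_monomial _ (hf.degree_eq_of_mem_support ha)
  · exact isHomogeneous_zero _ _ _

/-- Only supports of size between `1` and `m` contribute in positive degree `m`. -/
theorem suppProj_eq_zero_or {f : MvPolynomial σ K} {m : ℕ} (hf : f.IsHomogeneous m) (hm : 1 ≤ m)
    [DecidableEq σ] (I : Finset σ) : suppProj I f = 0 ∨ (1 ≤ I.card ∧ I.card ≤ m) := by
  rw [or_iff_not_imp_right]
  intro hI
  rw [suppProj_eq_sum]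
  refine Finset.sum_eq_zero fun a ha => ?_
  split_ifs with h
  · subst h
    have hd := hf.degree_eq_of_mem_support ha
    refine absurd ⟨?_, ?_⟩ hI
    · rw [Nat.one_le_iff_ne_zero, Finset.card_ne_zero, Finset.nonempty_iff_ne_empty]
      intro h0
      rw [Finsupp.support_eq_empty] at h0
      subst h0
      simp at hd
      omega
    -- Every exponent on the support is at least one, so the degree bounds the size of the support.
    · rw [← hd, Finsupp.degree_apply, Finset.card_eq_sum_ones]
      exact Finset.sum_le_sum fun i hi => Nat.one_le_iff_ne_zero.mpr (Finsupp.mem_support_iff.mp hi)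
  · rfl

variable [Fintype σ]

/-- The constant-coefficient derivation `∑ i, w i ∂/∂x_i`. -/
def dirDeriv (w : σ → K) : Derivation K (MvPolynomial σ K) (MvPolynomial σ K) :=
  ∑ i, w i • pderiv i

/-- The linear form `∑ i, w i x_i`. -/
def linForm (w : σ → K) : MvPolynomial σ K := ∑ i, w i • X i

/-- `dirDeriv` as an element of the endomorphism algebra. -/
def dirDerivEnd (w : σ → K) : Module.End K (MvPolynomial σ K) := (dirDeriv w).toLinearMap

/-- Multiplication by a linear form. -/
def linFormEnd (w : σ → K) : Module.End K (MvPolynomial σ K) := LinearMap.mulLeft K (linForm w)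

theorem dirDerivEnd_apply (w : σ → K) (f : MvPolynomial σ K) :
    dirDerivEnd w f = dirDeriv w f := rfl

theorem linFormEnd_apply (w : σ → K) (f : MvPolynomial σ K) :
    linFormEnd w f = linForm w * f := rfl

theorem dirDeriv_apply (w : σ → K) (f : MvPolynomial σ K) :
    dirDeriv w f = ∑ i, w i • pderiv i f := by
  change Derivation.coeFnAddMonoidHom (∑ i, w i • pderiv i) f = _
  rw [map_sum, Finset.sum_apply]
  rfl

theorem dirDeriv_X (w : σ → K) (i : σ) : dirDeriv w (X i) = C (w i) := by
  classical
  rw [dirDeriv_apply, Finset.sum_eq_single i (fun j _ hj => by rw [pderiv_X_of_ne hj.symm, smul_zero])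
    (by simp), pderiv_X_self, smul_eq_C_mul, mul_one]

theorem dirDeriv_linForm (w v : σ → K) :
    dirDeriv w (linForm v) = C (∑ i, v i * w i) := by
  simp [linForm, dirDeriv_X, smul_eq_C_mul]

/-- The pairing is symmetric, so the averaged weights can sit on either side: on the linear form for
the section, on the derivation for the retraction. -/
theorem dirDerivEnd_mul_linFormEnd {w v : σ → K} (h : ∑ i, v i * w i = 1) :
    dirDerivEnd w * linFormEnd v = linFormEnd v * dirDerivEnd w + 1 := by
  refine LinearMap.ext fun f => ?_
  simp [dirDerivEnd_apply, linFormEnd_apply, dirDeriv_linForm, h]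

/-! #### Compatibility with the grading -/

theorem IsHomogeneous.dirDerivEnd {f : MvPolynomial σ K} {m : ℕ} (hf : f.IsHomogeneous m)
    (w : σ → K) : (dirDerivEnd w f).IsHomogeneous (m - 1) := by
  rw [dirDerivEnd_apply, dirDeriv_apply]
  refine IsHomogeneous.sum _ _ _ fun i _ => ?_
  rw [smul_eq_C_mul]
  exact hf.pderiv.C_mul _

/-- The degree `m - 1` is truncated at `m = 0`, so the vanishing in degree zero has to be recorded
separately. -/
theorem dirDerivEnd_of_isHomogeneous_zero {f : MvPolynomial σ K} (hf : f.IsHomogeneous 0)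
    (w : σ → K) : dirDerivEnd w f = 0 := by
  rw [← totalDegree_zero_iff_isHomogeneous, totalDegree_eq_zero_iff_eq_C] at hf
  rw [hf, dirDerivEnd_apply, dirDeriv_apply]
  simp

theorem IsHomogeneous.linFormEnd {f : MvPolynomial σ K} {m : ℕ} (hf : f.IsHomogeneous m)
    (w : σ → K) : (linFormEnd w f).IsHomogeneous (m + 1) := by
  rw [linFormEnd_apply, add_comm]
  refine IsHomogeneous.mul (IsHomogeneous.sum _ _ _ fun i _ => ?_) hf
  rw [smul_eq_C_mul]
  exact (isHomogeneous_X K i).C_mul _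

theorem IsHomogeneous.dirDerivEnd_pow {f : MvPolynomial σ K} {m : ℕ} (hf : f.IsHomogeneous m)
    (w : σ → K) (k : ℕ) : ((MvPolynomial.dirDerivEnd w ^ k) f).IsHomogeneous (m - k) := by
  induction k with
  | zero => simpa using hf
  | succ k ih =>
    rw [pow_succ', Module.End.mul_apply, ← Nat.sub_sub]
    exact ih.dirDerivEnd w

theorem IsHomogeneous.linFormEnd_pow {f : MvPolynomial σ K} {m : ℕ} (hf : f.IsHomogeneous m)
    (w : σ → K) (k : ℕ) : ((MvPolynomial.linFormEnd w ^ k) f).IsHomogeneous (m + k) := by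
  induction k with
  | zero => simpa using hf
  | succ k ih =>
    rw [pow_succ', Module.End.mul_apply, ← Nat.add_assoc]
    exact ih.linFormEnd w

theorem dirDerivEnd_pow_eq_zero {f : MvPolynomial σ K} {m k : ℕ} (hf : f.IsHomogeneous m)
    (w : σ → K) (hk : m < k) : (dirDerivEnd w ^ k) f = 0 := by
  obtain ⟨j, rfl⟩ := Nat.exists_eq_add_of_lt hk
  have h := hf.dirDerivEnd_pow w m
  rw [Nat.sub_self] at h
  rw [show m + j + 1 = j + 1 + m by ring, pow_add, Module.End.mul_apply, pow_succ,
    Module.End.mul_apply, dirDerivEnd_of_isHomogeneous_zero h, map_zero]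

theorem IsHomogeneous.weylRight {f : MvPolynomial σ K} {m : ℕ} (hf : f.IsHomogeneous m)
    (w v : σ → K) : (weylRight K (MvPolynomial.dirDerivEnd w) (MvPolynomial.linFormEnd v) (m + 1)
      f).IsHomogeneous (m + 1) := by
  rw [_root_.weylRight, LinearMap.sum_apply]
  refine IsHomogeneous.sum _ _ _ fun k hk => ?_
  rw [LinearMap.smul_apply, smul_eq_C_mul, Module.End.mul_apply]
  have := (hf.dirDerivEnd_pow w k).linFormEnd_pow v (k + 1)
  -- The truncated difference is genuine because the sum stops at `k = m`.
  rw [show m - k + (k + 1) = m + 1 by have := Finset.mem_range.mp hk; omega] at this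
  exact this.C_mul _

theorem IsHomogeneous.weylLeft {f : MvPolynomial σ K} {m : ℕ} (hf : f.IsHomogeneous (m + 1))
    (w v : σ → K) : (weylLeft K (MvPolynomial.dirDerivEnd w) (MvPolynomial.linFormEnd v) (m + 1)
      f).IsHomogeneous m := by
  rw [_root_.weylLeft, LinearMap.sum_apply]
  refine IsHomogeneous.sum _ _ _ fun k hk => ?_
  rw [LinearMap.smul_apply, smul_eq_C_mul, Module.End.mul_apply]
  have := (hf.dirDerivEnd_pow w (k + 1)).linFormEnd_pow v k
  rw [show m + 1 - (k + 1) + k = m by have := Finset.mem_range.mp hk; omega] at this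
  exact this.C_mul _

/-! #### Equivariance -/

theorem semiconjBy_linFormEnd (g : Equiv.Perm σ) (w : σ → K) :
    SemiconjBy (renameEnd g) (linFormEnd w) (linFormEnd (w ∘ g.symm)) := by
  have h : rename g (linForm w) = linForm (w ∘ g.symm) := by
    rw [linForm, map_sum, linForm, ← Equiv.sum_comp g fun i => (w ∘ g.symm) i • X i]
    simp
  refine LinearMap.ext fun f => ?_
  simp [linFormEnd_apply, renameEnd_apply, h]

theorem semiconjBy_dirDerivEnd (g : Equiv.Perm σ) (w : σ → K) :
    SemiconjBy (renameEnd g) (dirDerivEnd w) (dirDerivEnd (w ∘ g.symm)) := by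
  refine LinearMap.ext fun f => ?_
  simp only [Module.End.mul_apply, dirDerivEnd_apply, renameEnd_apply, dirDeriv_apply, map_sum,
    map_smul]
  rw [← Equiv.sum_comp g (fun i => (w ∘ g.symm) i • pderiv i (rename g f))]
  refine Finset.sum_congr rfl fun i _ => ?_
  rw [pderiv_rename g.injective]
  simp

theorem commute_renameEnd_dirDerivEnd (g : Equiv.Perm σ) :
    Commute (renameEnd g) (dirDerivEnd (1 : σ → K)) :=
  semiconjBy_dirDerivEnd g 1

theorem commute_renameEnd_linFormEnd (g : Equiv.Perm σ) :
    Commute (renameEnd g) (linFormEnd (1 : σ → K)) :=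
  semiconjBy_linFormEnd g 1

/-- Reindexing by `I ↦ gI` turns the semiconjugation of the individual summands into commutation of
the whole sum with `g`. -/
theorem sum_comp_map (g : Equiv.Perm σ) {E : Type*} [AddCommMonoid E] (F : Finset σ → E) :
    ∑ I : Finset σ, F (I.map g.toEmbedding) = ∑ I, F I :=
  Equiv.sum_comp g.finsetCongr F

/-! #### Projections by support -/

variable [DecidableEq σ]

theorem sum_suppProj : ∑ I : Finset σ, suppProj I = (1 : Module.End K (MvPolynomial σ K)) := by
  refine (basisMonomials σ K).ext fun a => ?_
  simp [suppProj_monomial]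

/-! #### The equivariant section and retraction -/

theorem sum_avgWeight {I : Finset σ} (hI : (I.card : K) ≠ 0) : ∑ i, avgWeight K I i = 1 := by
  simp [avgWeight, hI]

variable (σ K) in
/-- An equivariant section, in degree `m`, of the sum of the partial derivatives. -/
def derivSection (m : ℕ) : Module.End K (MvPolynomial σ K) :=
  ∑ I : Finset σ, weylRight K (dirDerivEnd 1) (linFormEnd (avgWeight K I)) (m + 1) * suppProj I

variable (σ K) in
/-- An equivariant retraction, in degree `m`, of multiplication by the sum of the variables. -/
def mulRetraction (m : ℕ) : Module.End K (MvPolynomial σ K) :=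
  ∑ I : Finset σ, suppProj I * weylLeft K (dirDerivEnd (avgWeight K I)) (linFormEnd 1) (m + 1)

theorem commute_renameEnd_derivSection (g : Equiv.Perm σ) (m : ℕ) :
    Commute (renameEnd g) (derivSection σ K m) := by
  have h := SemiconjBy.sum_right (R := renameEnd g) Finset.univ fun (I : Finset σ) _ =>
    ((commute_renameEnd_dirDerivEnd (K := K) g).weylRight (K := K)
      (semiconjBy_linFormEnd g (avgWeight K I)) (m + 1)).mul_right (semiconjBy_suppProj g I)
  simp only [avgWeight_comp_symm] at h
  rwa [sum_comp_map g fun I =>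
    weylRight K (dirDerivEnd 1) (linFormEnd (avgWeight K I)) (m + 1) * suppProj I] at h

theorem commute_renameEnd_mulRetraction (g : Equiv.Perm σ) (m : ℕ) :
    Commute (renameEnd g) (mulRetraction σ K m) := by
  have h := SemiconjBy.sum_right (R := renameEnd g) Finset.univ fun (I : Finset σ) _ =>
    (semiconjBy_suppProj g I).mul_right ((semiconjBy_dirDerivEnd g (avgWeight K I)).weylLeft
      (K := K) (commute_renameEnd_linFormEnd (K := K) g) (m + 1))
  simp only [avgWeight_comp_symm] at h
  rwa [sum_comp_map g fun I =>
    suppProj I * weylLeft K (dirDerivEnd (avgWeight K I)) (linFormEnd 1) (m + 1)] at h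

theorem IsHomogeneous.derivSection {f : MvPolynomial σ K} {m : ℕ} (hf : f.IsHomogeneous m) :
    (derivSection σ K m f).IsHomogeneous (m + 1) := by
  rw [MvPolynomial.derivSection, LinearMap.sum_apply]
  exact IsHomogeneous.sum _ _ _ fun I _ => (hf.suppProj I).weylRight _ _

theorem IsHomogeneous.mulRetraction {f : MvPolynomial σ K} {m : ℕ}
    (hf : f.IsHomogeneous (m + 1)) : (mulRetraction σ K m f).IsHomogeneous m := by
  rw [MvPolynomial.mulRetraction, LinearMap.sum_apply]
  exact IsHomogeneous.sum _ _ _ fun I _ => (hf.weylLeft _ _).suppProj I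

/-- On each piece the remainder of `mul_weylRight` contains the `(m+1)`-st power of the derivation,
which kills degree `m`. The condition `1 ≤ m` excludes the empty support, over which there is no
average. -/
theorem dirDerivEnd_derivSection {f : MvPolynomial σ K} {m : ℕ} (hf : f.IsHomogeneous m)
    (h1 : 1 ≤ m) (hm : ((m + 1).factorial : K) ≠ 0) :
    dirDerivEnd 1 (derivSection σ K m f) = f := by
  rw [derivSection, LinearMap.sum_apply, map_sum]
  conv_rhs => rw [← Module.End.one_apply (R := K) f, ← sum_suppProj, LinearMap.sum_apply]
  refine Finset.sum_congr rfl fun I _ => ?_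
  rw [Module.End.mul_apply]
  rcases suppProj_eq_zero_or hf h1 I with h | ⟨h, h'⟩
  · simp [h]
  · have hI := natCast_ne_zero_of_factorial hm h (h'.trans m.le_succ)
    rw [← Module.End.mul_apply, mul_weylRight (dirDerivEnd_mul_linFormEnd (by
      simpa using sum_avgWeight hI)) hm]
    simp [dirDerivEnd_pow_eq_zero (hf.suppProj I)]

/-- Multiplication by the sum of the variables does not preserve supports, so the projections come
last: each left integration operator with `1 ≤ |I| ≤ m` recovers all of `f`, and the projection then
keeps the part supported on `I`. -/
theorem mulRetraction_linFormEnd {f : MvPolynomial σ K} {m : ℕ} (hf : f.IsHomogeneous m)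
    (h1 : 1 ≤ m) (hm : ((m + 1).factorial : K) ≠ 0) :
    mulRetraction σ K m (linFormEnd 1 f) = f := by
  rw [mulRetraction, LinearMap.sum_apply]
  conv_rhs => rw [← Module.End.one_apply (R := K) f, ← sum_suppProj, LinearMap.sum_apply]
  refine Finset.sum_congr rfl fun I _ => ?_
  rw [Module.End.mul_apply]
  by_cases hI : 1 ≤ I.card ∧ I.card ≤ m
  · have hI := natCast_ne_zero_of_factorial hm hI.1 (hI.2.trans m.le_succ)
    rw [← Module.End.mul_apply (weylLeft _ _ _ _), weylLeft_mul (dirDerivEnd_mul_linFormEnd (by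
      simpa using sum_avgWeight hI)) hm]
    simp [dirDerivEnd_pow_eq_zero hf]
  · rw [(suppProj_eq_zero_or ((hf.linFormEnd 1).weylLeft _ _) h1 I).resolve_right hI,
      (suppProj_eq_zero_or hf h1 I).resolve_right hI]

end MvPolynomial

/-! ### Functoriality of symmetric powers -/

section SymMap

open SymmetricAlgebra

variable {K : Type u} [Field K] {V W U : Type u} [AddCommGroup V] [Module K V]
  [AddCommGroup W] [Module K W] [AddCommGroup U] [Module K U]

/-- The algebra homomorphism of symmetric algebras induced by a linear map. -/
def symMap (a : V →ₗ[K] W) : SymmetricAlgebra K V →ₐ[K] SymmetricAlgebra K W :=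
  lift (ι K W ∘ₗ a)

@[simp]
theorem symMap_ι (a : V →ₗ[K] W) (v : V) : symMap a (ι K V v) = ι K W (a v) := by
  simp [symMap]

theorem symMap_symMap (b : W →ₗ[K] U) (a : V →ₗ[K] W) (x : SymmetricAlgebra K V) :
    symMap b (symMap a x) = symMap (b ∘ₗ a) x := by
  have h : (symMap b).comp (symMap a) = symMap (b ∘ₗ a) :=
    algHom_ext (LinearMap.ext fun v => by simp)
  exact congr($h x)

theorem symMap_id (x : SymmetricAlgebra K V) : symMap (LinearMap.id : V →ₗ[K] V) x = x := by
  have h : symMap (LinearMap.id : V →ₗ[K] V) = AlgHom.id K _ :=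
    algHom_ext (LinearMap.ext fun v => by simp)
  exact congr($h x)

theorem symMap_mem (a : V →ₗ[K] W) {r : ℕ} {x : SymmetricAlgebra K V} (hx : x ∈ SymPower K V r) :
    symMap a x ∈ SymPower K W r := by
  have h : Submodule.map (symMap a).toLinearMap (SymPower K V r) ≤ SymPower K W r := by
    rw [Submodule.map_pow]
    refine pow_le_pow_left' ?_ r
    rintro _ ⟨_, ⟨v, rfl⟩, rfl⟩
    exact ⟨a v, by simp⟩
  exact h ⟨x, hx, rfl⟩

/-- The linear map of symmetric powers induced by a linear map. -/
def symPowerMap (a : V →ₗ[K] W) (r : ℕ) : SymPower K V r →ₗ[K] SymPower K W r :=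
  (symMap a).toLinearMap.restrict fun _ => symMap_mem a

@[simp]
theorem coe_symPowerMap (a : V →ₗ[K] W) (r : ℕ) (x : SymPower K V r) :
    (symPowerMap a r x : SymmetricAlgebra K W) = symMap a x := rfl

theorem symMap_equivariant {G : Type*} [Group G] {ρ : Representation K G V}
    {τ : Representation K G W} {a : V →ₗ[K] W} (ha : ∀ g v, a (ρ g v) = τ g (a v)) (g : G)
    (x : SymmetricAlgebra K V) : symMap a (symMap (ρ g) x) = symMap (τ g) (symMap a x) := by
  rw [symMap_symMap, symMap_symMap, show a ∘ₗ ρ g = τ g ∘ₗ a from LinearMap.ext (ha g)]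

theorem ι_mul_mem_symPower (v : V) {r : ℕ} {x : SymmetricAlgebra K V} (hx : x ∈ SymPower K V r) :
    ι K V v * x ∈ SymPower K V (r + 1) := by
  rw [SymPower, pow_succ']
  exact Submodule.mul_mem_mul ⟨v, rfl⟩ hx

theorem algebraMap_mem_symPower_zero (c : K) :
    algebraMap K (SymmetricAlgebra K V) c ∈ SymPower K V 0 := by
  rw [SymPower, pow_zero]
  exact Submodule.algebraMap_mem c

/-- Symmetric powers of positive degree are spanned by products with a vector. -/
theorem symPower_succ_induction {r : ℕ} {P : SymmetricAlgebra K V → Prop}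
    (mul : ∀ v, ∀ x ∈ SymPower K V r, P (ι K V v * x)) (add : ∀ x y, P x → P y → P (x + y))
    {x : SymmetricAlgebra K V} (hx : x ∈ SymPower K V (r + 1)) : P x := by
  rw [SymPower, pow_succ'] at hx
  refine Submodule.mul_induction_on hx ?_ add
  rintro _ ⟨v, rfl⟩ y hy
  exact mul v y hy

/-- If `a` is the identity modulo `e`, then so is the induced map modulo the multiples of `e`. -/
theorem exists_sub_symMap_eq {a : V →ₗ[K] V} {e : V} (h : ∀ v, ∃ c : K, v - a v = c • e) {r : ℕ}
    {x : SymmetricAlgebra K V} (hx : x ∈ SymPower K V (r + 1)) :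
    ∃ y ∈ SymPower K V r, x - symMap a x = ι K V e * y := by
  induction r generalizing x with
  | zero =>
    rw [SymPower, zero_add, pow_one] at hx
    obtain ⟨v, rfl⟩ := hx
    obtain ⟨c, hc⟩ := h v
    refine ⟨algebraMap K _ c, algebraMap_mem_symPower_zero c, ?_⟩
    rw [symMap_ι, ← map_sub, hc, map_smul, Algebra.smul_def, mul_comm]
  | succ r ih =>
    refine symPower_succ_induction (P := fun x => ∃ y ∈ SymPower K V (r + 1),
      x - symMap a x = ι K V e * y) (fun v z hz => ?_) (fun y z => ?_) hx
    · obtain ⟨y, hy, hyz⟩ := ih hz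
      obtain ⟨c, hc⟩ := h v
      -- This comes from `v z - a(v) a(z) = v (z - a(z)) + (v - a(v)) a(z)`, where `a` also denotes
      -- the induced algebra map.
      refine ⟨ι K V v * y + c • symMap a z,
        add_mem (ι_mul_mem_symPower v hy) (Submodule.smul_mem _ c (symMap_mem a hz)), ?_⟩
      have hv : ι K V v - ι K V (a v) = c • ι K V e := by rw [← map_sub, hc, map_smul]
      rw [map_mul, symMap_ι, mul_add, mul_smul_comm, ← smul_mul_assoc, ← hv, mul_left_comm, ← hyz]
      ring
    · rintro ⟨y', hy', hy⟩ ⟨z', hz', hz⟩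
      refine ⟨y' + z', add_mem hy' hz', ?_⟩
      rw [map_add, mul_add, ← hy, ← hz]
      abel

theorem exists_rightInverse_of_surjective {q : V →ₗ[K] W} (hq : Function.Surjective q) :
    ∃ l : W →ₗ[K] V, ∀ w, q (l w) = w := by
  obtain ⟨l, hl⟩ := q.exists_rightInverse_of_surjective (LinearMap.range_eq_top.mpr hq)
  exact ⟨l, fun w => congr($hl w)⟩

theorem symPowerMap_surjective {q : V →ₗ[K] W} (hq : Function.Surjective q) (r : ℕ) :
    Function.Surjective (symPowerMap q r) := by
  obtain ⟨l, hl⟩ := exists_rightInverse_of_surjective hq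
  intro x
  refine ⟨symPowerMap l r x, Subtype.ext ?_⟩
  rw [coe_symPowerMap, coe_symPowerMap, symMap_symMap,
    show q ∘ₗ l = LinearMap.id from LinearMap.ext hl, symMap_id]

theorem symMap_injective_of_leftInverse {j : W →ₗ[K] V} {b : V →ₗ[K] W} (h : ∀ w, b (j w) = w) :
    Function.Injective (symMap j) := by
  refine Function.LeftInverse.injective (g := symMap b) fun x => ?_
  rw [symMap_symMap, show b ∘ₗ j = LinearMap.id from LinearMap.ext h, symMap_id]

/-- The kernel of `Sym^{r+1} V → Sym^{r+1} (V / ⟨e⟩)` consists of the multiples of `e`. -/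
theorem exists_ι_mul_eq_of_symMap_eq_zero {q : V →ₗ[K] W} (hq : Function.Surjective q) {e : V}
    (hker : ∀ v, q v = 0 → ∃ c : K, v = c • e) {r : ℕ} {x : SymmetricAlgebra K V}
    (hx : x ∈ SymPower K V (r + 1)) (h0 : symMap q x = 0) :
    ∃ y ∈ SymPower K V r, ι K V e * y = x := by
  obtain ⟨l, hl⟩ := exists_rightInverse_of_surjective hq
  -- For a linear section `l` of `q`, the map `l ∘ q` is the identity modulo `ker q`, and the map it
  -- induces kills `x`.
  obtain ⟨y, hy, hxy⟩ := exists_sub_symMap_eq (a := l ∘ₗ q) (e := e)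
    (fun v => hker _ (by simp [hl])) hx
  refine ⟨y, hy, ?_⟩
  rw [← hxy, ← symMap_symMap, h0, map_zero, sub_zero]

end SymMap

/-! ### Constant-coefficient derivations of the symmetric algebra -/

section Deriv

open SymmetricAlgebra

variable {K : Type u} [Field K] {V W : Type u} [AddCommGroup V] [Module K V]
  [AddCommGroup W] [Module K W] {φ : V →ₗ[K] K}
  {d : Derivation K (SymmetricAlgebra K V) (SymmetricAlgebra K V)}

theorem derivation_ι_mul
    (hd : ∀ v, d (ι K V v) = algebraMap K _ (φ v)) (v : V) (x : SymmetricAlgebra K V) :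
    d (ι K V v * x) = ι K V v * d x + φ v • x := by
  rw [d.leibniz, hd, smul_eq_mul, smul_eq_mul, mul_comm x, ← Algebra.smul_def]

theorem derivation_mem_symPower
    (hd : ∀ v, d (ι K V v) = algebraMap K _ (φ v)) {r : ℕ} {x : SymmetricAlgebra K V}
    (hx : x ∈ SymPower K V (r + 1)) : d x ∈ SymPower K V r := by
  induction r generalizing x with
  | zero =>
    rw [SymPower, zero_add, pow_one] at hx
    obtain ⟨v, rfl⟩ := hx
    rw [hd]
    exact algebraMap_mem_symPower_zero _
  | succ r ih =>
    refine symPower_succ_induction (P := fun x => d x ∈ SymPower K V (r + 1))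
      (fun v z hz => ?_) (fun y z hy hz => ?_) hx
    · rw [derivation_ι_mul hd]
      exact add_mem (ι_mul_mem_symPower v (ih hz)) (Submodule.smul_mem _ _ hz)
    · rw [map_add]
      exact add_mem hy hz

theorem derivation_pow_eq_zero
    (hd : ∀ v, d (ι K V v) = algebraMap K _ (φ v)) {r : ℕ} {x : SymmetricAlgebra K V}
    (hx : x ∈ SymPower K V r) :
    ((d : Module.End K (SymmetricAlgebra K V)) ^ (r + 1)) x = 0 := by
  induction r generalizing x with
  | zero =>
    rw [SymPower, pow_zero, Submodule.mem_one] at hx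
    obtain ⟨c, rfl⟩ := hx
    simp
  | succ r ih =>
    rw [pow_succ, Module.End.mul_apply]
    exact ih (derivation_mem_symPower hd hx)

theorem derivation_symMap_eq_zero
    (hd : ∀ v, d (ι K V v) = algebraMap K _ (φ v)) {j : W →ₗ[K] V} (hj : ∀ w, φ (j w) = 0)
    (x : SymmetricAlgebra K W) : d (symMap j x) = 0 := by
  induction x using SymmetricAlgebra.induction with
  | algebraMap c => simp
  | ι w => simp [hd, hj]
  | mul x y hx hy => simp [hx, hy]
  | add x y hx hy => simp [hx, hy]

/-- In degrees below the characteristic, no nonzero multiple of `e` is killed by `d`. -/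
theorem eq_zero_of_derivation_ι_mul_eq_zero
    (hd : ∀ v, d (ι K V v) = algebraMap K _ (φ v)) {e : V} (he : φ e = 1) {r : ℕ}
    (hr : ((r + 1).factorial : K) ≠ 0) {x : SymmetricAlgebra K V} (hx : x ∈ SymPower K V r)
    (h0 : d (ι K V e * x) = 0) : x = 0 := by
  set D : Module.End K (SymmetricAlgebra K V) := (d : SymmetricAlgebra K V →ₗ[K] SymmetricAlgebra K V)
  set X : Module.End K (SymmetricAlgebra K V) := LinearMap.mulLeft K (ι K V e)
  have hDX : D * X = X * D + 1 := by
    refine LinearMap.ext fun y => ?_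
    exact (derivation_ι_mul hd e y).trans (by simp [he, X, D])
  -- Descent on the exponent, from `D^{r+1} x = 0` for degree reasons down to `x = 0`. Since `D X x
  -- = 0`, the identity `D^{i+1} X = X D^{i+1} + (i+1) D^i` shows that `D^{i+1} x = 0` implies
  -- `(i+1) D^i x = 0`.
  have key : ∀ k ≤ r + 1, (D ^ (r + 1 - k)) x = 0 := by
    intro k
    induction k with
    | zero => exact fun _ => derivation_pow_eq_zero hd hx
    | succ k ih =>
      intro hk
      obtain ⟨i, rfl⟩ := Nat.exists_eq_add_of_le (Nat.le_of_succ_le_succ hk)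
      have h1 := ih (by omega)
      rw [show k + i + 1 - k = i + 1 by omega] at h1
      rw [show k + i + 1 - (k + 1) = i by omega]
      have h2 : (D ^ (i + 1) * X) x = 0 := by
        rw [pow_succ, mul_assoc, Module.End.mul_apply]
        exact (congrArg (D ^ i) h0).trans (map_zero _)
      rw [pow_succ_mul_of_weyl (K := K) hDX, LinearMap.add_apply, Module.End.mul_apply, h1,
        map_zero, zero_add, LinearMap.smul_apply, smul_eq_zero] at h2
      refine h2.resolve_left ?_
      exact_mod_cast natCast_ne_zero_of_factorial (k := i + 1) hr (by omega) (by omega)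
  simpa using key (r + 1) le_rfl

/-- In degrees below the characteristic, the kernel of `d` is the symmetric power of `ker φ`. -/
theorem symMap_symMap_of_derivation_eq_zero
    (hd : ∀ v, d (ι K V v) = algebraMap K _ (φ v)) {j : W →ₗ[K] V} {b : V →ₗ[K] W} {e : V}
    (he : φ e = 1) (hj : ∀ w, φ (j w) = 0) (hb : ∀ v, j (b v) = v - φ v • e) {r : ℕ}
    (hr : ((r + 1).factorial : K) ≠ 0) {x : SymmetricAlgebra K V}
    (hx : x ∈ SymPower K V (r + 1)) (h0 : d x = 0) : symMap j (symMap b x) = x := by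
  -- `j ∘ b` is the projection along `e` onto the kernel of `φ`. Both `x` and its image are killed
  -- by `d`, hence so is their difference `e * y`.
  obtain ⟨y, hy, hxy⟩ := exists_sub_symMap_eq (a := j ∘ₗ b) (e := e)
    (fun v => ⟨φ v, by simp [hb]⟩) hx
  have hy0 : y = 0 := by
    refine eq_zero_of_derivation_ι_mul_eq_zero hd he hr hy ?_
    rw [← hxy, map_sub, h0, ← symMap_symMap, derivation_symMap_eq_zero hd hj, sub_zero]
  rw [hy0, mul_zero, sub_eq_zero] at hxy
  rw [symMap_symMap, ← hxy]

end Deriv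

/-! ### Equivariant operators on the symmetric algebra of the permutation module -/

section NatPerm

open SymmetricAlgebra

variable (K : Type u) [Field K] (n : ℕ)

/-- The permutation basis of the natural permutation module. -/
def natPermBasis : Module.Basis (Fin n) K K[Fin n] :=
  .ofRepr (MonoidAlgebra.coeffLinearEquiv K)

theorem natPermBasis_apply (i : Fin n) :
    natPermBasis K n i = MonoidAlgebra.single i 1 := by
  rw [natPermBasis, Module.Basis.coe_ofRepr]
  rfl

theorem natPermRep_basis (g : Equiv.Perm (Fin n)) (i : Fin n) :
    natPermRep K n g (natPermBasis K n i) = natPermBasis K n (g i) := by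
  simp [natPermBasis_apply]

theorem natPermAug_basis (i : Fin n) : natPermAug K n (natPermBasis K n i) = 1 := by
  rw [natPermBasis_apply]
  change Finsupp.linearCombination K (fun _ : Fin n => (1 : K)) (Finsupp.single i 1) = 1
  simp

/-- The sum of the elements of the permutation basis. -/
def natPermSum : K[Fin n] := ∑ i, natPermBasis K n i

/-- The symmetric algebra of the natural permutation module as a polynomial ring. -/
def natPermPoly : SymmetricAlgebra K K[Fin n] ≃ₐ[K] MvPolynomial (Fin n) K :=
  equivMvPolynomial (natPermBasis K n)

theorem natPermPoly_ι (i : Fin n) :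
    natPermPoly K n (ι K _ (natPermBasis K n i)) = MvPolynomial.X i :=
  equivMvPolynomial_ι_apply _ i

theorem natPermPoly_symMap (g : Equiv.Perm (Fin n)) (x : SymmetricAlgebra K K[Fin n]) :
    natPermPoly K n (symMap (natPermRep K n g) x)
      = MvPolynomial.renameEnd g (natPermPoly K n x) := by
  have h : (natPermPoly K n).toAlgHom.comp (symMap (natPermRep K n g))
      = (MvPolynomial.rename g).comp (natPermPoly K n).toAlgHom := by
    refine algHom_ext ((natPermBasis K n).ext fun i => ?_)
    change natPermPoly K n (symMap (natPermRep K n g) (ι K _ (natPermBasis K n i)))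
      = MvPolynomial.rename g (natPermPoly K n (ι K _ (natPermBasis K n i)))
    rw [symMap_ι, natPermRep_basis, natPermPoly_ι, natPermPoly_ι, MvPolynomial.rename_X]
  exact congr($h x)

theorem natPermPoly_ι_sum :
    natPermPoly K n (ι K _ (natPermSum K n)) = MvPolynomial.linForm 1 := by
  simp [natPermSum, natPermPoly_ι, MvPolynomial.linForm]

/-- Both sides are `r`-th powers of submodules, so the comparison reduces to degree one, where both
are spanned by the variables. -/
theorem map_natPermPoly_symPower (r : ℕ) :
    (SymPower K K[Fin n] r).map (natPermPoly K n).toAlgHom.toLinearMap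
      = MvPolynomial.homogeneousSubmodule (Fin n) K r := by
  rw [Submodule.map_pow, ← MvPolynomial.homogeneousSubmodule_one_pow,
    MvPolynomial.homogeneousSubmodule_one_eq_span_X, ← Submodule.map_top,
    ← (natPermBasis K n).span_eq, Submodule.map_span, Submodule.map_span, ← Set.range_comp,
    ← Set.range_comp]
  congr 3
  ext1 i
  exact natPermPoly_ι K n i

variable {K n}

theorem natPermPoly_isHomogeneous {r : ℕ} {x : SymmetricAlgebra K K[Fin n]} :
    (natPermPoly K n x).IsHomogeneous r ↔ x ∈ SymPower K K[Fin n] r := by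
  rw [← MvPolynomial.mem_homogeneousSubmodule, ← map_natPermPoly_symPower]
  refine ⟨?_, fun h => ⟨x, h, rfl⟩⟩
  rintro ⟨y, hy, hxy⟩
  rwa [(natPermPoly K n).injective hxy] at hy

/-- Transport of an endomorphism of the polynomial ring. -/
def natPermEnd (T : Module.End K (MvPolynomial (Fin n) K)) :
    Module.End K (SymmetricAlgebra K K[Fin n]) :=
  (natPermPoly K n).symm.toLinearMap ∘ₗ T ∘ₗ (natPermPoly K n).toLinearMap

theorem natPermPoly_natPermEnd (T : Module.End K (MvPolynomial (Fin n) K))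
    (x : SymmetricAlgebra K K[Fin n]) :
    natPermPoly K n (natPermEnd T x) = T (natPermPoly K n x) := by
  simp [natPermEnd]

theorem natPermEnd_symMap {T : Module.End K (MvPolynomial (Fin n) K)} {g : Equiv.Perm (Fin n)}
    (hT : Commute (MvPolynomial.renameEnd g) T) (x : SymmetricAlgebra K K[Fin n]) :
    natPermEnd T (symMap (natPermRep K n g) x) = symMap (natPermRep K n g) (natPermEnd T x) := by
  apply (natPermPoly K n).injective
  rw [natPermPoly_symMap, natPermPoly_natPermEnd, natPermPoly_natPermEnd, natPermPoly_symMap]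
  exact congr($(hT.eq.symm) (natPermPoly K n x))

variable (K n)

/-- The derivation of the symmetric algebra extending the augmentation. -/
def augDeriv : Derivation K (SymmetricAlgebra K K[Fin n]) (SymmetricAlgebra K K[Fin n]) :=
  Derivation.mk' (natPermEnd (MvPolynomial.dirDerivEnd 1)) fun x y => by
    apply (natPermPoly K n).injective
    simp only [smul_eq_mul, map_add, map_mul, natPermPoly_natPermEnd,
      MvPolynomial.dirDerivEnd_apply, Derivation.leibniz]

variable {K n}

theorem augDeriv_apply (x : SymmetricAlgebra K K[Fin n]) :
    augDeriv K n x = natPermEnd (MvPolynomial.dirDerivEnd 1) x := rfl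

theorem augDeriv_ι (v : K[Fin n]) :
    augDeriv K n (ι K _ v) = algebraMap K _ (natPermAug K n v) := by
  have h : (augDeriv K n : _ →ₗ[K] SymmetricAlgebra K K[Fin n]) ∘ₗ ι K _
      = (Algebra.linearMap K _) ∘ₗ (natPermAug K n).toLinearMap := by
    refine (natPermBasis K n).ext fun i => ?_
    change natPermEnd (MvPolynomial.dirDerivEnd 1) (ι K _ (natPermBasis K n i))
      = algebraMap K _ (natPermAug K n (natPermBasis K n i))
    apply (natPermPoly K n).injective
    rw [natPermPoly_natPermEnd, natPermPoly_ι, MvPolynomial.dirDerivEnd_apply,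
      MvPolynomial.dirDeriv_X, natPermAug_basis]
    simp
  exact congr($h v)

theorem augDeriv_symMap (g : Equiv.Perm (Fin n)) (x : SymmetricAlgebra K K[Fin n]) :
    augDeriv K n (symMap (natPermRep K n g) x) = symMap (natPermRep K n g) (augDeriv K n x) :=
  natPermEnd_symMap (MvPolynomial.commute_renameEnd_dirDerivEnd g) x

/-- In positive degree below the characteristic, `augDeriv` has an equivariant section. -/
theorem exists_augDeriv_section {m : ℕ} (h1 : 1 ≤ m) (hm : ((m + 1).factorial : K) ≠ 0) :
    ∃ s : Module.End K (SymmetricAlgebra K K[Fin n]),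
      (∀ g x, s (symMap (natPermRep K n g) x) = symMap (natPermRep K n g) (s x)) ∧
      (∀ x ∈ SymPower K K[Fin n] m, s x ∈ SymPower K K[Fin n] (m + 1)) ∧
      ∀ x ∈ SymPower K K[Fin n] m, augDeriv K n (s x) = x := by
  refine ⟨natPermEnd (MvPolynomial.derivSection (Fin n) K m),
    fun g => natPermEnd_symMap (MvPolynomial.commute_renameEnd_derivSection g m),
    fun x hx => ?_, fun x hx => ?_⟩ <;> rw [← natPermPoly_isHomogeneous] at hx
  · rw [← natPermPoly_isHomogeneous, natPermPoly_natPermEnd]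
    exact hx.derivSection
  · apply (natPermPoly K n).injective
    rw [augDeriv_apply, natPermPoly_natPermEnd, natPermPoly_natPermEnd,
      MvPolynomial.dirDerivEnd_derivSection hx h1 hm]

/-- In positive degree below the characteristic, multiplication by the sum of the permutation
basis has an equivariant retraction. -/
theorem exists_natPermSum_retraction {m : ℕ} (h1 : 1 ≤ m) (hm : ((m + 1).factorial : K) ≠ 0) :
    ∃ t : Module.End K (SymmetricAlgebra K K[Fin n]),
      (∀ g x, t (symMap (natPermRep K n g) x) = symMap (natPermRep K n g) (t x)) ∧
      (∀ x ∈ SymPower K K[Fin n] (m + 1), t x ∈ SymPower K K[Fin n] m) ∧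
      ∀ x ∈ SymPower K K[Fin n] m, t (ι K _ (natPermSum K n) * x) = x := by
  refine ⟨natPermEnd (MvPolynomial.mulRetraction (Fin n) K m),
    fun g => natPermEnd_symMap (MvPolynomial.commute_renameEnd_mulRetraction g m),
    fun x hx => ?_, fun x hx => ?_⟩ <;> rw [← natPermPoly_isHomogeneous] at hx
  · rw [← natPermPoly_isHomogeneous, natPermPoly_natPermEnd]
    exact hx.mulRetraction
  · apply (natPermPoly K n).injective
    rw [natPermPoly_natPermEnd, map_mul, natPermPoly_ι_sum, ← MvPolynomial.linFormEnd_apply,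
      MvPolynomial.mulRetraction_linFormEnd hx h1 hm]

end NatPerm

/-! ### The Specht module and its head -/

section Specht

variable {K : Type u} [Field K] {n : ℕ}

theorem natPermRep_natPermSum (g : Equiv.Perm (Fin n)) :
    natPermRep K n g (natPermSum K n) = natPermSum K n := by
  rw [natPermSum, map_sum]
  simp only [natPermRep_basis]
  exact Equiv.sum_comp g (natPermBasis K n)

theorem natPermAug_natPermSum : natPermAug K n (natPermSum K n) = n := by
  rw [natPermSum, map_sum]
  simp [natPermAug_basis]

theorem mem_specht {v : K[Fin n]} :
    v ∈ (natPermAug K n).ker.toSubmodule ↔ natPermAug K n v = 0 := Iff.rfl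

theorem natPermAug_eq_sum (v : K[Fin n]) :
    natPermAug K n v = ∑ i, (natPermBasis K n).repr v i := by
  conv_lhs => rw [← (natPermBasis K n).sum_repr v, map_sum]
  simp [natPermAug_basis]

/-- A transposition only exchanges two coordinates. Consequently an invariant subspace containing a
non-constant vector contains some `x_i - x_j`. -/
theorem natPermRep_swap_sub (i j : Fin n) (v : K[Fin n]) :
    v - natPermRep K n (Equiv.swap i j) v
      = ((natPermBasis K n).repr v i - (natPermBasis K n).repr v j) •
        (natPermBasis K n i - natPermBasis K n j) := by
  have h : LinearMap.id - natPermRep K n (Equiv.swap i j)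
      = ((natPermBasis K n).coord i - (natPermBasis K n).coord j).smulRight
        (natPermBasis K n i - natPermBasis K n j) := by
    refine (natPermBasis K n).ext fun k => ?_
    simp only [LinearMap.sub_apply, LinearMap.id_apply, natPermRep_basis,
      LinearMap.smulRight_apply, Module.Basis.coord_apply, Module.Basis.repr_self]
    by_cases hi : k = i
    · subst hi
      by_cases hj : k = j
      · subst hj
        simp
      · simp [hj]
    · by_cases hj : k = j
      · subst hj
        simp [hi]
      · simp [hi, hj, Equiv.swap_apply_of_ne_of_ne hi hj]
  exact congr($h v)

/-- A subrepresentation of the permutation module that is not contained in the line of constant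
vectors contains the Specht module. -/
theorem specht_le_of_not_constant {U : Submodule K K[Fin n]}
    (hU : ∀ g, ∀ v ∈ U, natPermRep K n g v ∈ U) {v : K[Fin n]} (hv : v ∈ U)
    {i j : Fin n} (hij : (natPermBasis K n).repr v i ≠ (natPermBasis K n).repr v j) :
    (natPermAug K n).ker.toSubmodule ≤ U := by
  have h1 : natPermBasis K n i - natPermBasis K n j ∈ U := by
    have h := sub_mem hv (hU (Equiv.swap i j) v hv)
    rw [natPermRep_swap_sub] at h
    exact (Submodule.smul_mem_iff _ (sub_ne_zero.mpr hij)).mp h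
  -- The transposition of `i` and `k` fixes `j` when `k ≠ j`, so it carries `x_i - x_j` to `x_k -
  -- x_j`.
  have h2 : ∀ k, natPermBasis K n k - natPermBasis K n j ∈ U := by
    intro k
    by_cases hk : k = j
    · simp [hk]
    · have hji : j ≠ i := fun h => hij (by rw [h])
      have h := hU (Equiv.swap i k) _ h1
      rwa [map_sub, natPermRep_basis, natPermRep_basis, Equiv.swap_apply_left,
        Equiv.swap_apply_of_ne_of_ne hji (Ne.symm hk)] at h
  intro w hw
  rw [mem_specht, natPermAug_eq_sum] at hw
  -- The coordinates of `w` sum to zero, so subtracting `x_j` throughout changes nothing.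
  have e : w = ∑ k, (natPermBasis K n).repr w k • (natPermBasis K n k - natPermBasis K n j) := by
    simp only [smul_sub, Finset.sum_sub_distrib, ← Finset.sum_smul, hw, zero_smul, sub_zero]
    exact ((natPermBasis K n).sum_repr w).symm
  rw [e]
  exact sum_mem fun k _ => Submodule.smul_mem _ _ (h2 k)

variable (K n)

/-- The constant vector as an element of the Specht module. -/
def spechtSum (h : (n : K) = 0) : (natPermAug K n).ker.toSubmodule :=
  ⟨natPermSum K n, mem_specht.mpr (natPermAug_natPermSum.trans h)⟩

variable {K n}

theorem eq_smul_spechtSum (hn : 0 < n) (h : (n : K) = 0)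
    {v : (natPermAug K n).ker.toSubmodule}
    (hv : ∀ i j, (natPermBasis K n).repr v i = (natPermBasis K n).repr v j) :
    ∃ c : K, v = c • spechtSum K n h := by
  refine ⟨(natPermBasis K n).repr v ⟨0, hn⟩, Subtype.ext ?_⟩
  change (v : K[Fin n]) = _ • natPermSum K n
  rw [natPermSum, Finset.smul_sum]
  conv_lhs => rw [← (natPermBasis K n).sum_repr v]
  exact Finset.sum_congr rfl fun i _ => by rw [hv i]

theorem repr_smul_spechtSum (h : (n : K) = 0) (c : K) (i : Fin n) :
    (natPermBasis K n).repr (c • spechtSum K n h : (natPermAug K n).ker.toSubmodule) i = c := by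
  change (natPermBasis K n).repr (c • natPermSum K n) i = c
  simp [natPermSum, Finsupp.single_apply]

/-- If the characteristic divides `n ≥ 3`, the line of constant vectors is the radical of the
Specht module. -/
theorem mem_radRep_spechtRep (hn : 3 ≤ n) (h : (n : K) = 0)
    (v : (natPermAug K n).ker.toSubmodule) :
    v ∈ (radRep (spechtRep K n)).toSubmodule ↔ ∃ c : K, v = c • spechtSum K n h := by
  let e := Subrepresentation.subrepresentationSubmoduleOrderIso (ρ := spechtRep K n)
  let L : Subrepresentation (spechtRep K n) :=
    { toSubmodule := K ∙ spechtSum K n h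
      apply_mem_toSubmodule := by
        intro g v hv
        obtain ⟨c, rfl⟩ := Submodule.mem_span_singleton.mp hv
        rw [map_smul]
        refine Submodule.smul_mem _ _ ?_
        have : spechtRep K n g (spechtSum K n h) = spechtSum K n h :=
          Subtype.ext (natPermRep_natPermSum g)
        rw [this]
        exact Submodule.mem_span_singleton_self _ }
  have hL : ∀ v, v ∈ L ↔ ∃ c : K, v = c • spechtSum K n h := fun v =>
    Submodule.mem_span_singleton.trans (exists_congr fun c => eq_comm)
  -- With `L` proper, this makes `L` the only maximal subrepresentation, hence the radical.
  have hle : ∀ U : Subrepresentation (spechtRep K n), U ≤ L ∨ U = ⊤ := by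
    intro U
    rw [or_iff_not_imp_left]
    intro hU
    obtain ⟨v, hvU, hvL⟩ := SetLike.not_le_iff_exists.mp hU
    have hv : ∃ i j, (natPermBasis K n).repr v i ≠ (natPermBasis K n).repr v j := by
      by_contra! hc
      exact hvL ((hL v).mpr (eq_smul_spechtSum (by omega) h hc))
    obtain ⟨i, j, hij⟩ := hv
    have key := specht_le_of_not_constant
      (U := U.toSubmodule.map (natPermAug K n).ker.toSubmodule.subtype) (by
        rintro g _ ⟨w, hw, rfl⟩
        exact ⟨spechtRep K n g w, U.apply_mem_toSubmodule g hw, rfl⟩) ⟨v, hvU, rfl⟩ hij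
    rw [eq_top_iff]
    intro w _
    obtain ⟨w', hw', hww⟩ := key w.2
    rwa [← Subtype.ext hww]
  have hne : L ≠ ⊤ := by
    intro hL'
    have hw : natPermBasis K n ⟨0, by omega⟩ - natPermBasis K n ⟨1, by omega⟩
        ∈ (natPermAug K n).ker.toSubmodule := by
      rw [mem_specht, map_sub, natPermAug_basis, natPermAug_basis, sub_self]
    have hmem : (⟨_, hw⟩ : (natPermAug K n).ker.toSubmodule) ∈ L := by
      rw [hL']
      exact Submodule.mem_top
    obtain ⟨c, hc⟩ := (hL _).mp hmem
    have h0 := repr_smul_spechtSum h c ⟨0, by omega⟩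
    -- A third letter is essential: `x_0 - x_1` has coordinate `1` at `0` and `0` at `2`, so it is
    -- not constant. For `n = 2` in characteristic `2` it would be.
    have h2 := repr_smul_spechtSum h c ⟨2, by omega⟩
    rw [← hc] at h0 h2
    simp at h0 h2
    rw [← h2] at h0
    exact one_ne_zero h0
  have hco : IsCoatom (e L) := by
    rw [OrderIso.isCoatom_iff]
    refine ⟨hne, fun U hU => (hle U).resolve_left (not_le_of_gt hU)⟩
  have hrad : Module.jacobson K[Equiv.Perm (Fin n)] (spechtRep K n).asModule = e L := by
    refine le_antisymm (sInf_le hco) (le_sInf fun N hN => ?_)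
    obtain ⟨U, rfl⟩ := e.surjective N
    have hU : IsCoatom U := (OrderIso.isCoatom_iff e U).mp hN
    rw [e.le_iff_le]
    rcases hle U with h' | h'
    · exact (hU.le_iff_eq hne |>.mp h').le
    · exact absurd h' hU.1
  rw [← hL, radRep, hrad]
  rfl

end Specht

/-! ### The classes of the symmetric powers -/

section Main

open SymmetricAlgebra

variable {K : Type u} [Field K] {n : ℕ}

/-- The projection of the permutation module onto the Specht module along a basis vector. -/
def spechtProj (i : Fin n) : K[Fin n] →ₗ[K] (natPermAug K n).ker.toSubmodule :=
  (LinearMap.id - (natPermAug K n).toLinearMap.smulRight (natPermBasis K n i)).codRestrict _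
    fun v => by
      rw [mem_specht, LinearMap.sub_apply, map_sub, LinearMap.smulRight_apply, map_smul,
        natPermAug_basis]
      simp

theorem coe_spechtProj (i : Fin n) (v : K[Fin n]) :
    (spechtProj i v : K[Fin n]) = v - natPermAug K n v • natPermBasis K n i := rfl

theorem spechtProj_coe (i : Fin n) (v : (natPermAug K n).ker.toSubmodule) :
    spechtProj i (v : K[Fin n]) = v := by
  refine Subtype.ext ?_
  rw [coe_spechtProj, mem_specht.mp v.2, zero_smul, sub_zero]

theorem symMap_subtype_spechtProj (i : Fin n) {r : ℕ} (hr : ((r + 1).factorial : K) ≠ 0)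
    {x : SymmetricAlgebra K K[Fin n]} (hx : x ∈ SymPower K K[Fin n] (r + 1))
    (h0 : augDeriv K n x = 0) :
    symMap (natPermAug K n).ker.toSubmodule.subtype (symMap (spechtProj i) x) = x :=
  symMap_symMap_of_derivation_eq_zero (φ := (natPermAug K n).toLinearMap) augDeriv_ι
    (natPermAug_basis K n i) (fun w => mem_specht.mp w.2) (coe_spechtProj i) hr hx h0

theorem augDeriv_symMap_subtype (x : SymmetricAlgebra K (natPermAug K n).ker.toSubmodule) :
    augDeriv K n (symMap (natPermAug K n).ker.toSubmodule.subtype x) = 0 :=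
  derivation_symMap_eq_zero (φ := (natPermAug K n).toLinearMap) augDeriv_ι
    (fun w => mem_specht.mp w.2) x

theorem symMap_subtype_injective (i : Fin n) :
    Function.Injective (symMap (natPermAug K n).ker.toSubmodule.subtype) :=
  symMap_injective_of_leftInverse (b := spechtProj i) (spechtProj_coe i)

theorem symMap_subtype_equivariant (g : Equiv.Perm (Fin n))
    (x : SymmetricAlgebra K (natPermAug K n).ker.toSubmodule) :
    symMap (natPermAug K n).ker.toSubmodule.subtype (symMap (spechtRep K n g) x)
      = symMap (natPermRep K n g) (symMap (natPermAug K n).ker.toSubmodule.subtype x) :=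
  symMap_equivariant (fun _ _ => rfl) g x

/-- The class of `Sym^{m+1} M` is the sum of those of `Sym^{m+1} S` and `Sym^m M`. -/
theorem repClass_symPower_natPermRep (hn : 0 < n) {m : ℕ} (h1 : 1 ≤ m)
    (hm : ((m + 1).factorial : K) ≠ 0) :
    repClass (symPowerRep (natPermRep K n) (m + 1))
      = repClass (symPowerRep (spechtRep K n) (m + 1))
        + repClass (symPowerRep (natPermRep K n) m) := by
  obtain ⟨s, hsg, hsm, hs⟩ := exists_augDeriv_section (K := K) (n := n) h1 hm
  -- Projecting along one `x_i` is not equivariant, but it serves only to prove injectivity and to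
  -- identify the kernel.
  have i : Fin n := ⟨0, hn⟩
  refine repClass_eq_add_of_section
    (symPowerMap (natPermAug K n).ker.toSubmodule.subtype (m + 1))
    ((augDeriv K n : _ →ₗ[K] SymmetricAlgebra K K[Fin n]).restrict
      fun _ => derivation_mem_symPower (φ := (natPermAug K n).toLinearMap) augDeriv_ι)
    (s.restrict hsm) ?_ ?_ ?_ ?_ ?_ ?_
  · exact fun g x => Subtype.ext (symMap_subtype_equivariant (K := K) g x.1)
  · exact fun g x => Subtype.ext (hsg g x)
  · exact fun x y hxy => Subtype.ext (symMap_subtype_injective i congr(Subtype.val $hxy))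
  · exact fun x => Subtype.ext (augDeriv_symMap_subtype _)
  · exact fun x hx => ⟨symPowerMap (spechtProj i) (m + 1) x,
      Subtype.ext (symMap_subtype_spechtProj i hm x.2 congr(Subtype.val $hx))⟩
  · exact fun x => Subtype.ext (hs x x.2)

/-- If the characteristic divides `n ≥ 3`, the class of `Sym^{m+1} S` is the sum of those of
`Sym^m S` and `Sym^{m+1} D`. -/
theorem repClass_symPower_spechtRep (hn : 3 ≤ n) (h : (n : K) = 0) {m : ℕ} (h1 : 2 ≤ m)
    (hm : ((m + 1).factorial : K) ≠ 0) :
    repClass (symPowerRep (spechtRep K n) (m + 1))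
      = repClass (symPowerRep (spechtRep K n) m)
        + repClass (symPowerRep (simpleHeadRep K n) (m + 1)) := by
  obtain ⟨l, rfl⟩ := Nat.exists_eq_add_of_le' (show 1 ≤ m by omega)
  have hl := factorial_ne_zero_of_succ hm
  -- The section is taken one degree lower than the retraction, since it corrects the values of `t`.
  -- It needs `l ≥ 1`, which is where `2 ≤ m` enters.
  obtain ⟨s, hsg, hsm, hs⟩ := exists_augDeriv_section (K := K) (n := n) (m := l) (by omega) hl
  obtain ⟨t, htg, htm, ht⟩ := exists_natPermSum_retraction (K := K) (n := n) (m := l + 1)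
    (by omega) hm
  have i : Fin n := ⟨0, by omega⟩
  let j := (natPermAug K n).ker.toSubmodule.subtype
  let e := spechtSum K n h
  let q := (radRep (spechtRep K n)).toSubmodule.mkQ
  have hd : ∀ {r} {x : SymmetricAlgebra K K[Fin n]}, x ∈ SymPower K K[Fin n] (r + 1) →
      augDeriv K n x ∈ SymPower K K[Fin n] r :=
    derivation_mem_symPower (φ := (natPermAug K n).toLinearMap) augDeriv_ι
  -- The values of `t` need not lie in `Sym S`; the factor `1 - s ∂` projects them onto the kernel
  -- of `∂`.
  let T : SymmetricAlgebra K (natPermAug K n).ker.toSubmodule →ₗ[K] SymmetricAlgebra K K[Fin n] :=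
    (LinearMap.id - s ∘ₗ (augDeriv K n : _ →ₗ[K] SymmetricAlgebra K K[Fin n])) ∘ₗ t ∘ₗ
      (symMap j).toLinearMap
  have hT : ∀ x, T x = t (symMap j x) - s (augDeriv K n (t (symMap j x))) := fun x => rfl
  have hTm : ∀ x ∈ SymPower K _ (l + 1 + 1), T x ∈ SymPower K _ (l + 1) := fun x hx =>
    have hx' := htm _ (symMap_mem j hx)
    sub_mem hx' (hsm _ (hd hx'))
  have hTd : ∀ x ∈ SymPower K _ (l + 1 + 1), augDeriv K n (T x) = 0 := by
    intro x hx
    rw [hT, map_sub, hs _ (hd (htm _ (symMap_mem j hx))), sub_self]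
  have hTg : ∀ g x, T (symMap (spechtRep K n g) x) = symMap (natPermRep K n g) (T x) := by
    intro g x
    rw [hT, hT, symMap_subtype_equivariant, htg, augDeriv_symMap, hsg, map_sub]
  let R : SymPower K _ (l + 1 + 1) →ₗ[K] SymPower K _ (l + 1) :=
    symPowerMap (spechtProj i) (l + 1) ∘ₗ T.restrict hTm
  have hR : ∀ x, symMap j (R x) = T x := fun x =>
    symMap_subtype_spechtProj i hl (hTm x x.2) (hTd x x.2)
  refine repClass_eq_add_of_retraction
    ((LinearMap.mulLeft K (ι K _ e)).restrict fun x => ι_mul_mem_symPower e (x := x))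
    (symPowerMap q (l + 1 + 1)) R ?_ ?_ ?_ ?_ ?_ ?_
  · exact fun g x => Subtype.ext (symMap_equivariant (fun _ _ => rfl) g _)
  · intro g x
    -- `R` is defined through the non-equivariant `spechtProj i`, but its composite with the
    -- injective equivariant map `Sym S → Sym M` is `T`, which is equivariant.
    refine Subtype.ext (symMap_subtype_injective i ?_)
    refine (hR _).trans ((hTg g x).trans ?_)
    rw [← hR]
    exact (symMap_subtype_equivariant g _).symm
  · exact symPowerMap_surjective (Submodule.mkQ_surjective _) _
  · intro x
    refine Subtype.ext ?_
    have he : q e = 0 := by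
      rw [Submodule.mkQ_apply, Submodule.Quotient.mk_eq_zero, mem_radRep_spechtRep hn h]
      exact ⟨1, (one_smul _ _).symm⟩
    change symMap q (ι K _ e * x) = 0
    rw [map_mul, symMap_ι, he, map_zero, zero_mul]
  · intro x hx
    obtain ⟨y, hy, hxy⟩ := exists_ι_mul_eq_of_symMap_eq_zero (q := q) (e := e)
      (Submodule.mkQ_surjective _) (fun v hv => by
        rwa [Submodule.mkQ_apply, Submodule.Quotient.mk_eq_zero, mem_radRep_spechtRep hn h] at hv)
      x.2 congr(Subtype.val $hx)
    exact ⟨⟨y, hy⟩, Subtype.ext hxy⟩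
  · intro x
    refine Subtype.ext (symMap_subtype_injective i ?_)
    refine (hR _).trans ?_
    -- On multiples of `e` the map `t` already returns an element of `Sym S`, which `∂` kills, so
    -- the correction in `T` vanishes.
    have hx : t (symMap j (ι K _ e * x)) = symMap j x := by
      rw [map_mul, symMap_ι]
      exact ht _ (symMap_mem j x.2)
    change T (ι K _ e * x) = _
    rw [hT, hx, augDeriv_symMap_subtype, map_zero, sub_zero]

theorem factorial_ne_zero_of_le_pred {p : ℕ} (hp : p.Prime) [CharP K p] {r : ℕ} (hr : r ≤ p - 1) :
    (r.factorial : K) ≠ 0 := by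
  rw [Ne, CharP.cast_eq_zero_iff K p, hp.dvd_factorial]
  have := hp.pos
  omega

end Main

end

/-! ### The two formulas in the representation ring -/

theorem mainTheorem4 {K : Type u} [Field K] (p : ℕ) (hp : p.Prime) [CharP K p]
    (n : ℕ) (hn : 2 ≤ n) :
    (∀ r : ℕ, 2 ≤ r → r ≤ p - 1 →
      repClass (symPowerRep (spechtRep K n) r)
        = repClass (symPowerRep (natPermRep K n) r)
          - repClass (symPowerRep (natPermRep K n) (r - 1))) ∧
    (p ∣ n → ∀ r : ℕ, 3 ≤ r → r ≤ p - 1 →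
      repClass (symPowerRep (simpleHeadRep K n) r)
        = repClass (symPowerRep (natPermRep K n) r)
          + repClass (symPowerRep (natPermRep K n) (r - 2))
          - 2 * repClass (symPowerRep (natPermRep K n) (r - 1))) := by
  have specht : ∀ r : ℕ, 2 ≤ r → r ≤ p - 1 →
      repClass (symPowerRep (spechtRep K n) r)
        = repClass (symPowerRep (natPermRep K n) r)
          - repClass (symPowerRep (natPermRep K n) (r - 1)) := by
    intro r h2 hr
    obtain ⟨m, rfl⟩ := Nat.exists_eq_add_of_le' (show 1 ≤ r by omega)
    rw [repClass_symPower_natPermRep (by omega) (by omega) (factorial_ne_zero_of_le_pred hp hr),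
      Nat.add_sub_cancel, add_sub_cancel_right]
  refine ⟨specht, fun hpn r h3 hr => ?_⟩
  obtain ⟨m, rfl⟩ := Nat.exists_eq_add_of_le' (show 1 ≤ r by omega)
  -- The bounds `3 ≤ r ≤ p - 1` give `p ≥ 4`, so `n ≥ p` supplies the condition `n ≥ 3` needed to
  -- identify the radical.
  have hpn' : p ≤ n := Nat.le_of_dvd (by omega) hpn
  have key := repClass_symPower_spechtRep (K := K) (m := m) (by omega)
    ((CharP.cast_eq_zero_iff K p n).mpr hpn) (by omega) (factorial_ne_zero_of_le_pred hp hr)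
  rw [specht _ (by omega) hr, specht m (by omega) (by omega)] at key
  rw [show m + 1 - 2 = m - 1 by omega, Nat.add_sub_cancel] at *
  linear_combination -key
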